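/- Let $Q$ be a finite acyclic quiver with vertex set $Q_0$ and let $F$ be an algebraically closed field. For real vectors indexed by $Q_0$ let $$\langle \mathbf d,\mathbf e\rangle=\sum_{i\in Q_0}d_ie_i-\sum_{\alpha:i\to j}d_ie_j$$ be the Euler form. Let $\Theta,\kappa:\mathbb R Q_0\to\mathbb R$ be linear functionals such that $\kappa(x)>0$ for every non-zero $x\in\mathbb R_{\ge 0}Q_0$, and put $\mu=\Theta/\kappa$ on $\mathbb R_{\ge0}Q_0\setminus\{0\}$. Extend $\Theta,\kappa,\mu$ to finite-dimensional $F$-representations $V$ of $Q$ via the dimension vector $\mathbf{dim}(V)\in\mathbb N^{Q_0}$. For $0<\delta<1$ and $\epsilon>0$, a representation $V$ is a $(\delta,\epsilon)$-expander if $\mu(U)<\mu(V)-\epsilon$ for every non-zero subrepresentation $U\subseteq V$ with $\kappa(U)\le\delta\,\kappa(V)$. A sequence of dimension vectors, or of representations, is unbounded if the total dimensions of its members are unbounded. An unbounded sequence of representations $(V^{(k)})_{k\ge1}$ is a uniform expander if for every $\delta\in(0,1)$ there is an $\epsilon>0$ such that every $V^{(k)}$ is a $(\delta,\epsilon)$-expander.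 For a dimension vector $\mathbf d\in\mathbb N^{Q_0}$ and $\delta\in(0,1)$ let $$\epsilon^{\rm eff}_{\mathbf d}(\delta)=\min\{\mu(\mathbf d)-\mu(\mathbf e)\;:\;\mathbf e\in\mathbb N^{Q_0},\ 0\ne\mathbf e\le\mathbf d,\ \langle\mathbf e,\mathbf d-\mathbf e\rangle\ge0,\ \kappa(\mathbf e)\le\delta\,\kappa(\mathbf d)\},$$ where the minimum of the empty set is $+\infty$. **Lemma.** Let $(\mathbf d^k)_{k\ge1}$ be an unbounded sequence of dimension vectors in $\mathbb N^{Q_0}$. Assume that for every $\delta\in(0,1)$ there is a real number $\epsilon(\delta)>0$ such that $\epsilon^{\rm eff}_{\mathbf d^k}(\delta)\ge\epsilon(\delta)$ for all $k\ge1$. Then $(\mathbf d^k)_k$ supports a uniform expander, that is, there is a uniform expander $(V^{(k)})_{k\ge1}$ over $F$ with $\mathbf{dim}(V^{(k)})=\mathbf d^k$ for all $k\ge1$. -/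

import Mathlib

universe u v w

namespace QuiverExpander

/-- A quiver is acyclic if it has no oriented cycles: every path from a vertex to itself is
trivial (in particular there are no loops). -/
def IsAcyclic (Q : Type u) [Quiver.{v} Q] : Prop :=
  ∀ (i : Q) (p : Quiver.Path i i), p.length = 0

/-- A finite-dimensional `F`-representation of the quiver `Q`: a finite-dimensional vector space
for every vertex and a linear map for every arrow. -/
structure QRep (F : Type w) [Field F] (Q : Type u) [Quiver.{v} Q] where
  space : Q → Type w
  [addCommGroup : ∀ i, AddCommGroup (space i)]
  [module : ∀ i, Module F (space i)]
  [finiteDimensional : ∀ i, FiniteDimensional F (space i)]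
  map : ∀ {i j : Q}, (i ⟶ j) → (space i →ₗ[F] space j)

attribute [instance] QRep.addCommGroup QRep.module QRep.finiteDimensional

/-- A subrepresentation: a family of subspaces which is stable under all structure maps. -/
structure SubRep {F : Type w} [Field F] {Q : Type u} [Quiver.{v} Q] (V : QRep F Q) where
  space : ∀ i : Q, Submodule F (V.space i)
  map_mem : ∀ {i j : Q} (a : i ⟶ j) (x : V.space i), x ∈ space i → V.map a x ∈ space j

/-- The dimension vector of a representation. -/
noncomputable def QRep.dimVec {F : Type w} [Field F] {Q : Type u} [Quiver.{v} Q]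
    (V : QRep F Q) : Q → ℕ :=
  fun i => Module.finrank F (V.space i)

/-- The dimension vector of a subrepresentation. -/
noncomputable def SubRep.dimVec {F : Type w} [Field F] {Q : Type u} [Quiver.{v} Q]
    {V : QRep F Q} (U : SubRep V) : Q → ℕ :=
  fun i => Module.finrank F (U.space i)

/-- A subrepresentation is non-zero if one of its spaces is non-zero. -/
def SubRep.IsNonzero {F : Type w} [Field F] {Q : Type u} [Quiver.{v} Q]
    {V : QRep F Q} (U : SubRep V) : Prop :=
  ∃ i, U.space i ≠ ⊥

/-- A dimension vector, viewed in the real vector space with basis the vertices. -/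
def toReal {Q : Type u} (d : Q → ℕ) : Q → ℝ :=
  fun i => (d i : ℝ)

/-- The Euler form of a finite quiver. -/
noncomputable def eulerForm {Q : Type u} [Quiver.{v} Q] [Fintype Q]
    [∀ i j : Q, Fintype (i ⟶ j)] (d e : Q → ℝ) : ℝ :=
  ∑ i, d i * e i - ∑ i, ∑ j, ∑ _a : i ⟶ j, d i * e j

/-- A linear functional is positive if it is positive on all non-zero vectors with non-negative
coordinates. -/
def IsPositive {Q : Type u} (κ : Module.Dual ℝ (Q → ℝ)) : Prop :=
  ∀ x : Q → ℝ, 0 ≤ x → x ≠ 0 → 0 < κ x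

/-- The slope `Θ(d) / κ(d)`; only meaningful for `d ≠ 0`. -/
noncomputable def slope {Q : Type u} (Θ κ : Module.Dual ℝ (Q → ℝ)) (d : Q → ℕ) : ℝ :=
  Θ (toReal d) / κ (toReal d)

/-- `V` is a `(δ, ε)`-expander with respect to the slope function `Θ / κ`. -/
def IsExpander {F : Type w} [Field F] {Q : Type u} [Quiver.{v} Q]
    (Θ κ : Module.Dual ℝ (Q → ℝ)) (δ ε : ℝ) (V : QRep F Q) : Prop :=
  ∀ U : SubRep V, U.IsNonzero → κ (toReal U.dimVec) ≤ δ * κ (toReal V.dimVec) →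
    slope Θ κ U.dimVec < slope Θ κ V.dimVec - ε

/-- A sequence of dimension vectors is unbounded if the total dimensions are unbounded. -/
def IsUnbounded {Q : Type u} [Fintype Q] (d : ℕ+ → Q → ℕ) : Prop :=
  ∀ n : ℕ, ∃ k : ℕ+, n ≤ ∑ i, d k i

/-- A uniform `(δ, ε)`-expander: an unbounded family consisting of `(δ, ε)`-expanders. -/
def IsUniformExpanderWith {F : Type w} [Field F] {Q : Type u} [Quiver.{v} Q] [Fintype Q]
    (Θ κ : Module.Dual ℝ (Q → ℝ)) (δ ε : ℝ) (V : ℕ+ → QRep F Q) : Prop :=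
  IsUnbounded (fun k => (V k).dimVec) ∧ ∀ k, IsExpander Θ κ δ ε (V k)

/-- A uniform expander: an unbounded family which for every `δ` in `(0, 1)` is a uniform
`(δ, ε)`-expander for some positive `ε` depending on `δ` only. -/
def IsUniformExpander {F : Type w} [Field F] {Q : Type u} [Quiver.{v} Q] [Fintype Q]
    (Θ κ : Module.Dual ℝ (Q → ℝ)) (V : ℕ+ → QRep F Q) : Prop :=
  IsUnbounded (fun k => (V k).dimVec) ∧
    ∀ δ : ℝ, 0 < δ → δ < 1 → ∃ ε : ℝ, 0 < ε ∧ IsUniformExpanderWith Θ κ δ ε V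

/-- The sequence of dimension vectors `d` supports a uniform expander over `F`. -/
def SupportsUniformExpander (F : Type w) [Field F] {Q : Type u} [Quiver.{v} Q] [Fintype Q]
    (Θ κ : Module.Dual ℝ (Q → ℝ)) (d : ℕ+ → Q → ℕ) : Prop :=
  ∃ V : ℕ+ → QRep F Q, IsUniformExpander Θ κ V ∧ ∀ k, (V k).dimVec = d k

/-- The effective expansion coefficient of `d` at `δ`: the minimum of `μ(d) - μ(e)` over all
dimension vectors `0 ≠ e ≤ d` such that `⟨e, d - e⟩ ≥ 0` and `κ(e) ≤ δ κ(d)`. There are only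
finitely many such `e`, so the infimum is a minimum unless there are none, when it is `⊤`. -/
noncomputable def effCoeff {Q : Type u} [Quiver.{v} Q] [Fintype Q]
    [∀ i j : Q, Fintype (i ⟶ j)] (Θ κ : Module.Dual ℝ (Q → ℝ)) (d : Q → ℕ) (δ : ℝ) : EReal :=
  sInf {x : EReal | ∃ e : Q → ℕ, e ≠ 0 ∧ e ≤ d ∧
    0 ≤ eulerForm (toReal e) (toReal d - toReal e) ∧
    κ (toReal e) ≤ δ * κ (toReal d) ∧
    x = ((slope Θ κ d - slope Θ κ e : ℝ) : EReal)}

end QuiverExpander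

/-! A general representation `V` of dimension vector `d` has only subrepresentations whose dimension
vectors `e` satisfy `⟨e, d - e⟩ ≥ 0`; these `e` are the ones `effCoeff` ranges over, so its lower
bound controls every subrepresentation of `V`. For generality, cover the pairs (representation,
subrepresentation) by finitely many affine charts, one for each choice of coordinate sets `S i`
(`exists_coordinate_chart`, `exists_chart_of_subRep`). A chart has `dim R_d + ⟨e, d - e⟩` parameters
(`card_chartParam`). If the Euler form is negative, these are too few to fill `R_d`, and the matrix
entries satisfy a nontrivial polynomial relation (`exists_polynomial_relation`). Over an infinite
field some representation violates all these relations at once. -/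

namespace QuiverExpander

open MvPolynomial

/-! ### Coordinate charts for subspaces and polynomial relations -/

section Chart

variable {F : Type w} [Field F]

/-- Every subspace of `F ^ n` is the graph of a linear map over a coordinate subspace: there is a
set `S` of coordinates whose restrictions to `U` form a basis of the dual of `U`, and the columns
of `A` indexed by `S` are the dual basis of `U`. -/
theorem exists_coordinate_chart {n : ℕ} (U : Submodule F (Fin n → F)) :
    ∃ (S : Finset (Fin n)) (A : Fin n → Fin n → F), S.card = Module.finrank F U ∧
      (∀ r ∈ S, ∀ s ∈ S, A r s = if r = s then 1 else 0) ∧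
      (∀ s ∈ S, (fun r => A r s) ∈ U) ∧
      ∀ x ∈ U, ∀ r, x r = ∑ s ∈ S, A r s * x s := by
  classical
  let φ : Fin n → Module.Dual F U := fun r => (LinearMap.proj r).comp U.subtype
  have hφ (r : Fin n) (x : U) : φ r x = x.1 r := rfl
  -- The coordinate functions have no common zero in `U` except 0, so they span its dual; a basis
  -- can be extracted from them.
  have htop : Submodule.span F (Set.range φ) = ⊤ := by
    rw [← Subspace.dualCoannihilator_dualAnnihilator_eq (W := Submodule.span F (Set.range φ))]
    have : (Submodule.span F (Set.range φ)).dualCoannihilator = ⊥ := by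
      rw [eq_bot_iff]
      intro x hx
      rw [Submodule.mem_dualCoannihilator] at hx
      rw [Submodule.mem_bot]
      ext r
      exact hx (φ r) (Submodule.subset_span ⟨r, rfl⟩)
    rw [this, Submodule.dualAnnihilator_bot]
  obtain ⟨t, -, -, hspan, hli⟩ :=
    exists_linearIndepOn_extension (K := F) (v := φ) (s := ∅) (t := Set.univ)
      (linearIndepOn_empty F φ) (Set.empty_subset _)
  have hspan' : ⊤ ≤ Submodule.span F (Set.range fun s : t => φ s) := by
    rw [← htop, Submodule.span_le]
    rw [Set.image_univ, Set.image_eq_range] at hspan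
    exact hspan
  let b : Module.Basis t F (Module.Dual F U) := Module.Basis.mk hli hspan'
  have hb (s : t) : b s = φ s := Module.Basis.mk_apply ..
  -- The basis of `U` dual to `b`, through the identification of `U` with its double dual.
  let u : t → U := fun s => (Module.evalEquiv F U).symm (b.dualBasis s)
  have hu (s : t) (f : Module.Dual F U) : f (u s) = b.repr f s := by
    simp [u]
  refine ⟨t.toFinset, fun r s => if h : s ∈ t then (u ⟨s, h⟩).1 r else 0, ?_, ?_, ?_, ?_⟩
  · rw [Set.toFinset_card, ← Subspace.dual_finrank_eq (K := F) (V := U),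
      Module.finrank_eq_card_basis b]
  · intro r hr s hs
    rw [Set.mem_toFinset] at hr hs
    have h := hu ⟨s, hs⟩ (φ r)
    rw [← hb ⟨r, hr⟩, Module.Basis.repr_self, hb, hφ] at h
    simp [hs, h, Finsupp.single_apply]
  · intro s hs
    rw [Set.mem_toFinset] at hs
    simp [hs]
  · intro x hx r
    have h := congrArg (fun f : Module.Dual F U => f ⟨x, hx⟩) (b.sum_repr (φ r))
    simp only [LinearMap.sum_apply, LinearMap.smul_apply, hb, hφ, smul_eq_mul] at h
    rw [← h, ← Finset.sum_coe_sort t.toFinset]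
    refine Fintype.sum_equiv (Equiv.subtypeEquivRight fun s => by simp) _ _ fun s => ?_
    simp [← hu, hφ]

/-- A family of more polynomials than variables satisfies a nontrivial polynomial relation. -/
theorem exists_polynomial_relation {σ τ : Type*} [Fintype σ] [Fintype τ]
    (h : Fintype.card σ < Fintype.card τ) (f : τ → MvPolynomial σ F) :
    ∃ P : MvPolynomial τ F, P ≠ 0 ∧ ∀ x : σ → F, eval (fun t => eval x (f t)) P = 0 := by
  -- Independence would force `card τ` to be at most the transcendence degree of `MvPolynomial σ F`,
  -- which is `card σ`.
  have hf : ¬ AlgebraicIndependent F f := by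
    intro hf
    have := hf.lift_cardinalMk_le_trdeg
    rw [MvPolynomial.trdeg_of_isDomain] at this
    simp only [Cardinal.mk_fintype, Cardinal.lift_natCast, Nat.cast_le] at this
    omega
  rw [algebraicIndependent_iff] at hf
  push Not at hf
  obtain ⟨P, hP, hP0⟩ := hf
  refine ⟨P, hP0, fun x => ?_⟩
  have := congrArg (eval x) hP
  rw [map_zero, aeval_def, ← coe_eval₂Hom, ← RingHom.comp_apply] at this
  rw [← this]
  congr 1
  ext <;> simp

/-- Finitely many nonzero polynomials over an infinite field have a common point where none of
them vanishes. -/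
theorem exists_forall_eval_ne_zero [Infinite F] {τ ι : Type*} [Finite ι]
    (P : ι → MvPolynomial τ F) (hP : ∀ i, P i ≠ 0) :
    ∃ x : τ → F, ∀ i, eval x (P i) ≠ 0 := by
  have := Fintype.ofFinite ι
  by_contra! h
  -- The product of the `P i` would vanish at every point, hence be zero, as `F` is infinite.
  refine Finset.prod_ne_zero_iff (s := Finset.univ).2 (fun i _ => hP i) (MvPolynomial.funext (q := 0) fun x => ?_)
  obtain ⟨i, hi⟩ := h x
  rw [map_zero, map_prod]
  exact Finset.prod_eq_zero (Finset.mem_univ i) hi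

end Chart

/-! ### General representations and their subrepresentations -/

section General

variable {Q : Type u} [Quiver.{v} Q] (d : Q → ℕ)

/-- The matrix entries of a representation with dimension vector `d`. -/
abbrev Entry : Type (max u v) := Σ (i j : Q) (_ : i ⟶ j), Fin (d j) × Fin (d i)

variable {d} (S : ∀ i : Q, Finset (Fin (d i)))

/-- The entries mapping the coordinate subspaces given by `S` to their complements. -/
def IsBlock (q : Entry d) : Prop := q.2.2.2.1 ∉ S q.2.1 ∧ q.2.2.2.2 ∈ S q.1

/-- The parameters of pairs of a representation and a subrepresentation in the chart `S`. -/
abbrev ChartParam : Type (max u v) :=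
  {p : Σ i : Q, Fin (d i) × Fin (d i) // p.2.1 ∉ S p.1 ∧ p.2.2 ∈ S p.1} ⊕
    {q : Entry d // ¬ IsBlock S q}

variable {S}

variable {F : Type w} [Field F]

/-- The chart coordinates `A` and `M` of a subrepresentation satisfy the equation expressing the
stability of the subspaces. -/
theorem block_entry_eq {m n : ℕ} {S : Finset (Fin m)} {T : Finset (Fin n)}
    {A : Fin m → Fin m → F} {B : Fin n → Fin n → F} {M : Fin n → Fin m → F}
    (hA : ∀ r ∈ S, ∀ s ∈ S, A r s = if r = s then 1 else 0) {s : Fin m} (hs : s ∈ S)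
    (hM : ∀ r, ∑ c, M r c * A c s = ∑ t ∈ T, B r t * ∑ c, M t c * A c s) (r : Fin n) :
    M r s = ∑ t ∈ T, B r t * (M t s + ∑ c ∈ Sᶜ, M t c * A c s) - ∑ c ∈ Sᶜ, M r c * A c s := by
  -- The rows of `A` in `S` form an identity matrix, which isolates `M r s`. For `r ∉ T` this solves
  -- for a block entry in terms of non-block entries only.
  have key (r : Fin n) : ∑ c, M r c * A c s = M r s + ∑ c ∈ Sᶜ, M r c * A c s := by
    rw [← Finset.sum_add_sum_compl S]
    congr 1
    rw [Finset.sum_eq_single_of_mem s hs fun c hc hcs => by simp [hA c hc s hs, hcs]]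
    simp [hA s hs s hs]
  simp only [key] at hM
  exact eq_sub_of_add_eq (hM r)

variable (F S) in
open Classical in
/-- The coordinates of the subrepresentation, as polynomials in the parameters. -/
noncomputable def subspaceVar (i : Q) (r s : Fin (d i)) : MvPolynomial (ChartParam S) F :=
  if h : r ∉ S i ∧ s ∈ S i then X (Sum.inl ⟨⟨i, r, s⟩, h⟩) else 0

variable (F S) in
open Classical in
/-- The free entries of the representation, as polynomials in the parameters. -/
noncomputable def entryVar (q : Entry d) : MvPolynomial (ChartParam S) F :=
  if h : ¬ IsBlock S q then X (Sum.inr ⟨q, h⟩) else 0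

variable (F S) in
open Classical in
/-- The entries of a representation with a subrepresentation in the chart `S`, as polynomials in
the parameters. -/
noncomputable def chartEntry : Entry d → MvPolynomial (ChartParam S) F
  | ⟨i, j, a, r, s⟩ =>
    if IsBlock S ⟨i, j, a, r, s⟩ then
      -- All indices here are genuine parameters, so the default 0 of `subspaceVar` and `entryVar`
      -- is never used.
      ∑ t ∈ S j, subspaceVar S F j r t * (entryVar S F ⟨i, j, a, t, s⟩ +
        ∑ c ∈ (S i)ᶜ, entryVar S F ⟨i, j, a, t, c⟩ * subspaceVar S F i c s) -
        ∑ c ∈ (S i)ᶜ, entryVar S F ⟨i, j, a, r, c⟩ * subspaceVar S F i c s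
    else entryVar S F ⟨i, j, a, r, s⟩

variable (F) in
/-- The representation with the given matrix entries. -/
noncomputable def repOfEntries (M : Entry d → F) : QRep F Q where
  space i := Fin (d i) → F
  map {i j} a := Matrix.toLin' (Matrix.of fun r c => M ⟨i, j, a, r, c⟩)

theorem dimVec_repOfEntries (M : Entry d → F) : (repOfEntries F M).dimVec = d := by
  funext i
  exact Module.finrank_fin_fun F

/-- A representation is in the image of the chart of each of its subrepresentations. -/
theorem exists_chart_of_subRep (M : Entry d → F) (U : SubRep (repOfEntries F M)) :
    ∃ S : ∀ i : Q, Finset (Fin (d i)), (fun i => (S i).card) = U.dimVec ∧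
      ∃ x : ChartParam S → F, (fun q => eval x (chartEntry S F q)) = M := by
  classical
  choose S A hcard hA hAU hU using fun i => exists_coordinate_chart (F := F) (n := d i) (U.space i)
  refine ⟨S, funext hcard, Sum.elim (fun p => A p.1.1 p.1.2.1 p.1.2.2) (fun q => M q.1), ?_⟩
  set x : ChartParam S → F := Sum.elim (fun p => A p.1.1 p.1.2.1 p.1.2.2) (fun q => M q.1)
  have hsub (i : Q) (r s : Fin (d i)) (hr : r ∉ S i) (hs : s ∈ S i) :
      eval x (subspaceVar S F i r s) = A i r s := by
    rw [subspaceVar, dif_pos ⟨hr, hs⟩, eval_X]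
    rfl
  have hent (q : Entry d) (hq : ¬ IsBlock S q) : eval x (entryVar S F q) = M q := by
    rw [entryVar, dif_pos hq, eval_X]
    rfl
  funext ⟨i, j, a, r, s⟩
  rw [chartEntry]
  split_ifs with h
  · obtain ⟨hr, hs⟩ := h
    -- Column `s` of `A i` lies in `U`, so its image lies in `U.space j` and obeys the chart
    -- equations there.
    have hM := block_entry_eq (M := fun r c => M ⟨i, j, a, r, c⟩) (hA i) hs
      (fun r => hU j _ (U.map_mem a _ (hAU i s hs)) r) r
    rw [hM]
    simp only [map_sub, map_sum, map_mul, map_add]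
    congr 1
    · refine Finset.sum_congr rfl fun t ht => ?_
      rw [hsub j r t hr ht, hent _ fun h => h.1 ht]
      congr 2
      refine Finset.sum_congr rfl fun c hc => ?_
      rw [hent _ fun h => h.1 ht, hsub i c s (Finset.mem_compl.1 hc) hs]
    · refine Finset.sum_congr rfl fun c hc => ?_
      rw [hent _ fun h => Finset.mem_compl.1 hc h.2, hsub i c s (Finset.mem_compl.1 hc) hs]
  · exact hent _ h

variable [Fintype Q] [∀ i j : Q, Fintype (i ⟶ j)]

/-- The number of parameters of the chart `S` is `dim R_d + ⟨e, d - e⟩`, where `R_d` is the space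
of representations and `e` is the dimension vector of the subrepresentations in the chart. -/
theorem card_chartParam [Fintype (ChartParam S)] : (Fintype.card (ChartParam S) : ℝ) =
    Fintype.card (Entry d) + eulerForm (toReal fun i => (S i).card)
      (toReal d - toReal fun i => (S i).card) := by
  classical
  have hc (i : Q) : (((S i)ᶜ.card : ℕ) : ℝ) = (d i : ℝ) - (S i).card := by
    rw [Finset.card_compl, Fintype.card_fin, Nat.cast_sub]
    simpa using (S i).card_le_univ
  -- The subspace coordinates give the vertex sum of the Euler form; the block entries, which are
  -- not free, give the arrow sum.
  have h1 : (Fintype.card {p : Σ i : Q, Fin (d i) × Fin (d i) //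
      p.2.1 ∉ S p.1 ∧ p.2.2 ∈ S p.1} : ℝ) =
      ∑ i, ((S i).card : ℝ) * ((d i : ℝ) - (S i).card) := by
    let e : {p : Σ i : Q, Fin (d i) × Fin (d i) // p.2.1 ∉ S p.1 ∧ p.2.2 ∈ S p.1} ≃
        Σ i : Q, {r // r ∈ (S i)ᶜ} × {s // s ∈ S i} :=
      { toFun p := ⟨p.1.1, ⟨p.1.2.1, Finset.mem_compl.2 p.2.1⟩, ⟨p.1.2.2, p.2.2⟩⟩
        invFun p := ⟨⟨p.1, p.2.1.1, p.2.2.1⟩, Finset.mem_compl.1 p.2.1.2, p.2.2.2⟩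
        left_inv _ := rfl
        right_inv _ := rfl }
    rw [Fintype.card_congr e]
    simp only [Fintype.card_sigma, Fintype.card_prod, Fintype.card_coe, Nat.cast_sum,
      Nat.cast_mul, hc]
    exact Finset.sum_congr rfl fun i _ => mul_comm _ _
  have h2 : (Fintype.card {q : Entry d // IsBlock S q} : ℝ) =
      ∑ i, ∑ j, ∑ _a : i ⟶ j, ((S i).card : ℝ) * ((d j : ℝ) - (S j).card) := by
    let e : {q : Entry d // IsBlock S q} ≃
        Σ (i j : Q) (_ : i ⟶ j), {r // r ∈ (S j)ᶜ} × {s // s ∈ S i} :=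
      { toFun p := ⟨p.1.1, p.1.2.1, p.1.2.2.1, ⟨p.1.2.2.2.1, Finset.mem_compl.2 p.2.1⟩,
          ⟨p.1.2.2.2.2, p.2.2⟩⟩
        invFun p := ⟨⟨p.1, p.2.1, p.2.2.1, p.2.2.2.1.1, p.2.2.2.2.1⟩,
          Finset.mem_compl.1 p.2.2.2.1.2, p.2.2.2.2.2⟩
        left_inv _ := rfl
        right_inv _ := rfl }
    rw [Fintype.card_congr e]
    simp only [Fintype.card_sigma, Fintype.card_prod, Fintype.card_coe, Nat.cast_sum,
      Nat.cast_mul, hc]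
    refine Finset.sum_congr rfl fun i _ => Finset.sum_congr rfl fun j _ =>
      Finset.sum_congr rfl fun a _ => mul_comm _ _
  have h3 : (Fintype.card {q : Entry d // IsBlock S q} : ℝ) +
      Fintype.card {q : Entry d // ¬ IsBlock S q} = Fintype.card (Entry d) := by
    rw [Fintype.card_subtype_compl, Nat.cast_sub (Fintype.card_subtype_le _)]
    ring
  have h4 : Fintype.card (ChartParam S) = Fintype.card {p : Σ i : Q, Fin (d i) × Fin (d i) //
      p.2.1 ∉ S p.1 ∧ p.2.2 ∈ S p.1} + Fintype.card {q : Entry d // ¬ IsBlock S q} := by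
    rw [← Fintype.card_sum]
    congr!
  rw [h4, Nat.cast_add, h1, ← h3, h2]
  simp only [eulerForm, toReal, Pi.sub_apply]
  ring

variable (F d) in
/-- Over an infinite field there is a representation with dimension vector `d` such that
`⟨e, d - e⟩ ≥ 0` for the dimension vectors `e` of all subrepresentations. -/
theorem exists_rep_forall_eulerForm_nonneg [Infinite F] :
    ∃ V : QRep F Q, V.dimVec = d ∧
      ∀ U : SubRep V, 0 ≤ eulerForm (toReal U.dimVec) (toReal d - toReal U.dimVec) := by
  classical
  let ι := {S : ∀ i : Q, Finset (Fin (d i)) //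
    eulerForm (toReal fun i => (S i).card) (toReal d - toReal fun i => (S i).card) < 0}
  have hex (S : ι) : ∃ P : MvPolynomial (Entry d) F, P ≠ 0 ∧
      ∀ x, eval (fun q => eval x (chartEntry S.1 F q)) P = 0 := by
    refine exists_polynomial_relation ?_ _
    have := card_chartParam (S := S.1)
    have h := S.2
    rw [← Nat.cast_lt (α := ℝ)]
    linarith
  choose P hP hPx using hex
  obtain ⟨M, hM⟩ := exists_forall_eval_ne_zero P hP
  refine ⟨repOfEntries F M, dimVec_repOfEntries M, fun U => ?_⟩
  by_contra! h
  obtain ⟨S, hS, x, hx⟩ := exists_chart_of_subRep M U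
  rw [← hS] at h
  exact hM ⟨S, h⟩ (hx ▸ hPx ⟨S, h⟩ x)

end General

end QuiverExpander

open QuiverExpander in
-- Each subrepresentation to be tested has a dimension vector admissible in `effCoeff`. The infimum
-- gives only a weak inequality, so strictness needs `ε' < ε`.
theorem isExpander_of_forall_eulerForm_nonneg {F : Type w} [Field F]
    {Q : Type u} [Quiver.{v} Q] [Fintype Q] [∀ i j : Q, Fintype (i ⟶ j)]
    {Θ κ : Module.Dual ℝ (Q → ℝ)} {V : QRep F Q}
    (hV : ∀ U : SubRep V,
      0 ≤ eulerForm (toReal U.dimVec) (toReal V.dimVec - toReal U.dimVec))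
    {δ ε ε' : ℝ} (hε : ε' < ε) (heff : (ε : EReal) ≤ effCoeff Θ κ V.dimVec δ) :
    IsExpander Θ κ δ ε' V := by
  intro U ⟨i, hi⟩ hκU
  have h : effCoeff Θ κ V.dimVec δ ≤
      ((slope Θ κ V.dimVec - slope Θ κ U.dimVec : ℝ) : EReal) := by
    refine sInf_le ⟨U.dimVec, fun h0 => hi ?_, fun i => Submodule.finrank_le _, hV U, hκU, rfl⟩
    exact Submodule.finrank_eq_zero.1 (congrFun h0 i)
  have := EReal.coe_le_coe_iff.1 (heff.trans h)
  linarith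

theorem lemma3p4 {F : Type w} [Field F] [IsAlgClosed F]
    {Q : Type u} [Quiver.{v} Q] [Fintype Q] [∀ i j : Q, Fintype (i ⟶ j)]
    (hQ : QuiverExpander.IsAcyclic Q)
    (Θ κ : Module.Dual ℝ (Q → ℝ)) (hκ : QuiverExpander.IsPositive κ)
    (d : ℕ+ → Q → ℕ) (hd : QuiverExpander.IsUnbounded d)
    (heff : ∀ δ : ℝ, 0 < δ → δ < 1 → ∃ ε : ℝ, 0 < ε ∧
      ∀ k : ℕ+, (ε : EReal) ≤ QuiverExpander.effCoeff Θ κ (d k) δ) :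
    QuiverExpander.SupportsUniformExpander F Θ κ d := by
  have : Infinite F := IsAlgClosed.instInfinite
  choose V hVd hV using fun k => QuiverExpander.exists_rep_forall_eulerForm_nonneg (d k) F
  have hunb : QuiverExpander.IsUnbounded (fun k => (V k).dimVec) := by simpa only [hVd] using hd
  refine ⟨V, ⟨hunb, fun δ h0 h1 => ?_⟩, hVd⟩
  obtain ⟨ε, hε, h⟩ := heff δ h0 h1
  -- Any positive constant below `ε` would do; it does not depend on `k`.
  refine ⟨ε / 2, half_pos hε, hunb, fun k => ?_⟩
  refine isExpander_of_forall_eulerForm_nonneg ?_ (half_lt_self hε) ?_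
  · simpa only [hVd] using hV k
  · simpa only [hVd] using h k
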